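/- Let $p$ be a prime number. For a pro-$p$ group $G$ write $H^i(G)=H^i(G,\mathbb{Z}/p)$ for the profinite (continuous) cohomology of $G$ with coefficients in the trivial discrete module $\mathbb{Z}/p$. A pro-$p$ group $G$ is called Demuškin if (i) $\dim_{\mathbb{F}_p}H^1(G)<\infty$; (ii) $\dim_{\mathbb{F}_p}H^2(G)=1$; (iii) the cup product $\cup\colon H^1(G)\times H^1(G)\to H^2(G)$ is a non-degenerate bilinear map. If $G_1,G_2$ are closed subgroups of a pro-$p$ group $G$, we say that $G$ is the free pro-$p$ product $G=G_1*_pG_2$ if $G$, together with the two inclusion maps, is the coproduct of $G_1$ and $G_2$ in the category of pro-$p$ groups and continuous homomorphisms; that is, for every pro-$p$ group $H$ and all continuous homomorphisms $f_i\colon G_i\to H$ ($i=1,2$) there is a unique continuous homomorphism $f\colon G\to H$ whose restriction to $G_i$ is $f_i$ for $i=1,2$. Then a pro-$p$ Demuškin group $G$ cannot be decomposed as a free pro-$p$ product $G=G_1*_pG_2$ of nontrivial closed subgroups $G_1,G_2$ of $G$. -/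

import Mathlib

universe u

/-- A topological group is *pro-`p`* if it is profinite (compact, Hausdorff and totally
disconnected) and all its quotients by open normal subgroups are `p`-groups. -/
structure IsProP (p : ℕ) (G : Type u) [Group G] [TopologicalSpace G] [IsTopologicalGroup G] :
    Prop where
  compactSpace : CompactSpace G
  t2Space : T2Space G
  totallyDisconnectedSpace : TotallyDisconnectedSpace G
  isPGroup_quotient : ∀ N : OpenNormalSubgroup G, IsPGroup p (G ⧸ N.toSubgroup)

/-- `G` is the (internal) free pro-`p` product `G₁ *ₚ G₂` of its subgroups `G₁` and `G₂`: together
with the two inclusion maps, `G` is their coproduct in the category of pro-`p` groups and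
continuous homomorphisms. -/
def IsFreeProPProduct (p : ℕ) {G : Type u} [Group G] [TopologicalSpace G] [IsTopologicalGroup G]
    (G₁ G₂ : Subgroup G) : Prop :=
  IsProP p G ∧ IsProP p G₁ ∧ IsProP p G₂ ∧
    ∀ (H : Type u) [Group H] [TopologicalSpace H] [IsTopologicalGroup H], IsProP p H →
      ∀ (f₁ : G₁ →ₜ* H) (f₂ : G₂ →ₜ* H),
        ∃! f : G →ₜ* H, (∀ x : G₁, f x = f₁ x) ∧ (∀ x : G₂, f x = f₂ x)

/-! Continuous cohomology `Hⁱ(G) = Hⁱ(G, ℤ/p)`, `i = 1, 2`, with the trivial action on the discrete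
module `ℤ/p`, computed by the complex of inhomogeneous continuous cochains
`C⁰ → C¹ → C² → C³`, where `Cⁿ` is the space of continuous maps `Gⁿ → ℤ/p`. The map `C⁰ → C¹` is
zero, since the action is trivial. -/

namespace ProPCohomology

variable (p : ℕ) (G : Type u) [Group G] [TopologicalSpace G] [IsTopologicalGroup G]

/-- The differential `C¹ → C²`, `(∂f)(g, h) = f(h) - f(gh) + f(g)`. -/
def d₁ : C(G, ZMod p) →ₗ[ZMod p] C(G × G, ZMod p) where
  toFun f := ⟨fun x => f x.2 - f (x.1 * x.2) + f x.1, by fun_prop⟩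
  map_add' f f' := by
    ext x
    simp only [ContinuousMap.coe_mk, ContinuousMap.add_apply]
    ring
  map_smul' a f := by
    ext x
    simp only [ContinuousMap.coe_mk, ContinuousMap.smul_apply, smul_eq_mul, RingHom.id_apply]
    ring

/-- The differential `C² → C³`,
`(∂c)(g, h, k) = c(h, k) - c(gh, k) + c(g, hk) - c(g, h)`. -/
def d₂ : C(G × G, ZMod p) →ₗ[ZMod p] C(G × G × G, ZMod p) where
  toFun c := ⟨fun x => c (x.2.1, x.2.2) - c (x.1 * x.2.1, x.2.2) + c (x.1, x.2.1 * x.2.2)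
    - c (x.1, x.2.1), by fun_prop⟩
  map_add' c c' := by
    ext x
    simp only [ContinuousMap.coe_mk, ContinuousMap.add_apply]
    ring
  map_smul' a c := by
    ext x
    simp only [ContinuousMap.coe_mk, ContinuousMap.smul_apply, smul_eq_mul, RingHom.id_apply]
    ring

/-- `H¹(G, ℤ/p)`: the kernel of `C¹ → C²`, that is, the continuous homomorphisms `G → ℤ/p`. -/
abbrev H1 : Type u := LinearMap.ker (d₁ p G)

/-- The continuous `2`-cocycles. -/
abbrev Z2 : Submodule (ZMod p) C(G × G, ZMod p) := LinearMap.ker (d₂ p G)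

/-- The continuous `2`-coboundaries, as a submodule of the `2`-cocycles. -/
abbrev B2 : Submodule (ZMod p) (Z2 p G) := (LinearMap.range (d₁ p G)).submoduleOf (Z2 p G)

/-- `H²(G, ℤ/p)`: continuous `2`-cocycles modulo continuous `2`-coboundaries. -/
abbrev H2 : Type u := Z2 p G ⧸ B2 p G

/-- Coboundaries are cocycles. -/
theorem range_d₁_le : LinearMap.range (d₁ p G) ≤ Z2 p G := by
  rintro _ ⟨f, rfl⟩
  ext x
  simp only [d₁, d₂, LinearMap.coe_mk, AddHom.coe_mk, ContinuousMap.coe_mk,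
    ContinuousMap.zero_apply, mul_assoc]
  ring

variable {p G}

theorem H1.map_mul (χ : H1 p G) (g h : G) : χ.1 (g * h) = χ.1 g + χ.1 h := by
  have := congrArg (fun c : C(G × G, ZMod p) => c (g, h)) χ.2
  simp only [d₁, LinearMap.coe_mk, AddHom.coe_mk, ContinuousMap.coe_mk,
    ContinuousMap.zero_apply] at this
  linear_combination -this

/-- The cup product of `1`-cocycles: `(χ ∪ ψ)(g, h) = χ(g) ψ(h)`. -/
def cupCocycle (χ ψ : H1 p G) : Z2 p G :=
  ⟨⟨fun x => χ.1 x.1 * ψ.1 x.2, by fun_prop⟩, by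
    ext x
    simp only [d₂, LinearMap.coe_mk, AddHom.coe_mk, ContinuousMap.coe_mk,
      ContinuousMap.zero_apply, H1.map_mul]
    ring⟩

variable (p G)

/-- The cup product `H¹(G, ℤ/p) × H¹(G, ℤ/p) → H²(G, ℤ/p)`. -/
def cup : H1 p G →ₗ[ZMod p] H1 p G →ₗ[ZMod p] H2 p G :=
  LinearMap.mk₂ (ZMod p) (fun χ ψ => (B2 p G).mkQ (cupCocycle χ ψ))
    (fun χ χ' ψ => by
      rw [← map_add]; congr 1; ext x
      simp [cupCocycle, add_mul])
    (fun a χ ψ => by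
      rw [← map_smul]; congr 1; ext x
      simp [cupCocycle, mul_assoc])
    (fun χ ψ ψ' => by
      rw [← map_add]; congr 1; ext x
      simp [cupCocycle, mul_add])
    (fun a χ ψ => by
      rw [← map_smul]; congr 1; ext x
      simp [cupCocycle, mul_left_comm])

end ProPCohomology

/-- A pro-`p` group `G` is *Demuškin* if `H¹(G, ℤ/p)` is finite-dimensional, `H²(G, ℤ/p)` is
one-dimensional, and the cup product `H¹(G, ℤ/p) × H¹(G, ℤ/p) → H²(G, ℤ/p)` is non-degenerate. -/
structure IsDemushkin (p : ℕ) [Fact p.Prime] (G : Type u) [Group G] [TopologicalSpace G]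
    [IsTopologicalGroup G] : Prop where
  isProP : IsProP p G
  finite_H1 : FiniteDimensional (ZMod p) (ProPCohomology.H1 p G)
  finrank_H2 : Module.finrank (ZMod p) (ProPCohomology.H2 p G) = 1
  nondegenerate : (ProPCohomology.cup p G).Nondegenerate

/-! Restriction `H²(G) → H²(G₁) ⊕ H²(G₂)` is injective for a free pro-`p` product: a cocycle gives a
pro-`p` central extension, trivialisations over the factors are partial sections, and the universal
property glues them (`IsFreeProPProduct.exists_cochain`). The same gluing yields nonzero classes
`χ₁`, `χ₂` in `H¹(G)`, with `χ₁` zero on `G₂` and `χ₂` zero on `G₁`. In a Demuškin group some `χ₁ ∪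
ψ₁` and `χ₂ ∪ ψ₂` are nonzero, hence proportional. The first dies on `G₂` and the second on `G₁`, so
both die on both factors, contradicting injectivity. -/

open ProPCohomology

/-- The central extension of `G` by `ZMod p` defined by a continuous `2`-cocycle. -/
def CocycleExtension {p : ℕ} {G : Type u} [Group G] [TopologicalSpace G] [IsTopologicalGroup G]
    (_ : Z2 p G) : Type u := ZMod p × G

namespace CocycleExtension

variable {p : ℕ} {G : Type u} [Group G] [TopologicalSpace G] [IsTopologicalGroup G] (c : Z2 p G)

instance : TopologicalSpace (CocycleExtension c) :=
  inferInstanceAs (TopologicalSpace (ZMod p × G))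

variable {c}

/-- The component of an element of the extension in `ZMod p`. -/
def fst (x : CocycleExtension c) : ZMod p := Prod.fst x

/-- The component of an element of the extension in `G`. -/
def snd (x : CocycleExtension c) : G := Prod.snd x

variable (c) in
/-- The element of the extension with given components. -/
def mk (a : ZMod p) (g : G) : CocycleExtension c := (a, g)

@[simp] theorem fst_mk (a : ZMod p) (g : G) : (mk c a g).fst = a := rfl

@[simp] theorem snd_mk (a : ZMod p) (g : G) : (mk c a g).snd = g := rfl

@[ext] theorem ext {x y : CocycleExtension c} (h₁ : x.fst = y.fst) (h₂ : x.snd = y.snd) : x = y :=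
  Prod.ext h₁ h₂

@[fun_prop]
theorem continuous_fst : Continuous (fst : CocycleExtension c → ZMod p) :=
  _root_.continuous_fst (X := ZMod p) (Y := G)

@[fun_prop]
theorem continuous_snd : Continuous (snd : CocycleExtension c → G) :=
  _root_.continuous_snd (X := ZMod p) (Y := G)

theorem continuous_mk {X : Type*} [TopologicalSpace X] {f : X → ZMod p} {φ : X → G}
    (hf : Continuous f) (hφ : Continuous φ) : Continuous fun x => mk c (f x) (φ x) :=
  Continuous.prodMk hf hφ

variable (c)

theorem cocycle_identity (g h k : G) :
    c.1 (h, k) - c.1 (g * h, k) + c.1 (g, h * k) - c.1 (g, h) = 0 :=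
  congrArg (fun d : C(G × G × G, ZMod p) => d (g, h, k)) c.2

theorem cocycle_one_left (g : G) : c.1 (1, g) = c.1 (1, 1) := by
  have h := cocycle_identity c 1 1 g
  simp only [one_mul] at h
  linear_combination h

instance : Mul (CocycleExtension c) :=
  ⟨fun x y => mk c (x.fst + y.fst + c.1 (x.snd, y.snd)) (x.snd * y.snd)⟩

-- The cocycle need not be normalised, so the identity is shifted by `c (1, 1)`.
instance : One (CocycleExtension c) := ⟨mk c (-c.1 (1, 1)) 1⟩

instance : Inv (CocycleExtension c) :=
  ⟨fun x => mk c (-x.fst - c.1 (x.snd⁻¹, x.snd) - c.1 (1, 1)) x.snd⁻¹⟩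

variable {c}

theorem mul_def (x y : CocycleExtension c) :
    x * y = mk c (x.fst + y.fst + c.1 (x.snd, y.snd)) (x.snd * y.snd) := rfl

theorem one_def : (1 : CocycleExtension c) = mk c (-c.1 (1, 1)) 1 := rfl

theorem inv_def (x : CocycleExtension c) :
    x⁻¹ = mk c (-x.fst - c.1 (x.snd⁻¹, x.snd) - c.1 (1, 1)) x.snd⁻¹ := rfl

variable (c)

instance : Group (CocycleExtension c) :=
  Group.ofLeftAxioms
    (fun x y z => by
      ext
      · simp only [mul_def, fst_mk, snd_mk]
        linear_combination -cocycle_identity c x.snd y.snd z.snd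
      · simp only [mul_def, snd_mk, mul_assoc])
    (fun x => by
      ext
      · simp only [mul_def, one_def, fst_mk, snd_mk, cocycle_one_left]
        ring
      · simp only [mul_def, one_def, snd_mk, one_mul])
    (fun x => by
      ext
      · simp only [mul_def, one_def, inv_def, fst_mk, snd_mk]
        ring
      · simp only [mul_def, one_def, inv_def, snd_mk, inv_mul_cancel])

instance : IsTopologicalGroup (CocycleExtension c) where
  continuous_mul := continuous_mk (by fun_prop) (by fun_prop)
  continuous_inv := continuous_mk (by fun_prop) (by fun_prop)

/-- The projection of the extension onto `G`. -/
def proj : CocycleExtension c →ₜ* G where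
  toFun := snd
  map_one' := rfl
  map_mul' _ _ := rfl
  continuous_toFun := continuous_snd

theorem pow_eq_one_of_proj_eq_one [Fact p.Prime] (x : CocycleExtension c) (hx : proj c x = 1) :
    x ^ p = 1 := by
  have hx' : x.snd = 1 := hx
  -- On the kernel of `proj`, the first component plus `c (1, 1)` is an additive coordinate.
  have key : ∀ n : ℕ, x ^ n = mk c ((n : ZMod p) * (x.fst + c.1 (1, 1)) - c.1 (1, 1)) 1 := by
    intro n
    induction n with
    | zero => simp only [pow_zero, Nat.cast_zero, zero_mul, zero_sub]; rfl
    | succ n ih =>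
      rw [pow_succ, ih, mul_def]
      ext
      · simp only [fst_mk, snd_mk, hx']; push_cast; ring
      · simp only [snd_mk, hx', mul_one]
  rw [key, CharP.cast_eq_zero, zero_mul, zero_sub]
  rfl

/-- Modulo `N`, some `x ^ p ^ k` agrees with an element of the kernel of `proj`, and one further
`p`-th power kills it. -/
theorem isProP [Fact p.Prime] (hG : IsProP p G) : IsProP p (CocycleExtension c) := by
  obtain ⟨_, _, _, hq⟩ := hG
  refine ⟨inferInstanceAs (CompactSpace (ZMod p × G)), inferInstanceAs (T2Space (ZMod p × G)),
    inferInstanceAs (TotallyDisconnectedSpace (ZMod p × G)), fun N => ?_⟩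
  have hsurj : Function.Surjective (proj c) := fun g => ⟨mk c 0 g, rfl⟩
  let M : OpenNormalSubgroup G :=
    { toSubgroup := N.toSubgroup.map (proj c : CocycleExtension c →* G)
      isOpen' := isOpenMap_snd (X := ZMod p) (Y := G) _ N.isOpen'
      isNormal' := N.isNormal'.map _ hsurj }
  intro y
  obtain ⟨x, rfl⟩ := QuotientGroup.mk_surjective y
  have : M.toSubgroup.Normal := M.isNormal'
  obtain ⟨k, hk⟩ := hq M (proj c x : G)
  rw [← QuotientGroup.mk_pow, QuotientGroup.eq_one_iff] at hk
  obtain ⟨n, hn, hnx⟩ := hk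
  have hz : (n⁻¹ * x ^ p ^ k) ^ p = 1 := by
    refine pow_eq_one_of_proj_eq_one c _ ?_
    rw [map_mul, map_inv, map_pow]
    exact inv_mul_eq_one.2 hnx
  refine ⟨k + 1, ?_⟩
  have hn' : (n : CocycleExtension c ⧸ N.toSubgroup) = 1 := (QuotientGroup.eq_one_iff n).2 hn
  have := congrArg (QuotientGroup.mk (s := N.toSubgroup)) hz
  rw [QuotientGroup.mk_pow, QuotientGroup.mk_mul, QuotientGroup.mk_inv, hn', inv_one, one_mul,
    QuotientGroup.mk_pow] at this
  rw [pow_succ, pow_mul, this]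
  rfl

/-- A cochain on `K` whose coboundary is the restriction of `c` lifts a homomorphism `K → G` to
the extension. -/
def lift {K : Type u} [Group K] [TopologicalSpace K] (φ : K →ₜ* G) (f : C(K, ZMod p))
    (hf : ∀ g h, f h - f (g * h) + f g = c.1 (φ g, φ h)) : K →ₜ* CocycleExtension c where
  -- The sign is forced: multiplication adds `c`, while `∂f` subtracts `f (g * h)`.
  toFun g := mk c (-f g) (φ g)
  map_one' := by
    have h := hf 1 1
    simp only [mul_one, map_one] at h
    ext
    · simp only [one_def, fst_mk]
      linear_combination -h
    · simp only [one_def, snd_mk, map_one]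
  map_mul' g h := by
    ext
    · simp only [mul_def, fst_mk, snd_mk]
      linear_combination hf g h
    · simp only [mul_def, snd_mk, map_mul]
  continuous_toFun := continuous_mk (by fun_prop) (by fun_prop)

end CocycleExtension

/-- The inclusion of a subgroup as a continuous homomorphism. -/
def Subgroup.continuousSubtype {G : Type u} [Group G] [TopologicalSpace G] (K : Subgroup G) :
    K →ₜ* G where
  toMonoidHom := K.subtype
  continuous_toFun := continuous_subtype_val

/-- If the restrictions of a `2`-cocycle to both free factors are coboundaries, then it is a
coboundary, of a cochain with prescribed restrictions. -/
theorem IsFreeProPProduct.exists_cochain {p : ℕ} [Fact p.Prime] {G : Type u} [Group G]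
    [TopologicalSpace G] [IsTopologicalGroup G] {G₁ G₂ : Subgroup G}
    (h : IsFreeProPProduct p G₁ G₂) (c : Z2 p G) (f₁ : C(G₁, ZMod p)) (f₂ : C(G₂, ZMod p))
    (h₁ : ∀ x y : G₁, f₁ y - f₁ (x * y) + f₁ x = c.1 (x, y))
    (h₂ : ∀ x y : G₂, f₂ y - f₂ (x * y) + f₂ x = c.1 (x, y)) :
    ∃ f : C(G, ZMod p), d₁ p G f = c.1 ∧ (∀ x : G₁, f x = f₁ x) ∧ ∀ x : G₂, f x = f₂ x := by
  obtain ⟨hG, -, -, huniv⟩ := h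
  obtain ⟨s, ⟨hs₁, hs₂⟩, -⟩ := huniv (CocycleExtension c) (CocycleExtension.isProP c hG)
    (CocycleExtension.lift c G₁.continuousSubtype f₁ h₁)
    (CocycleExtension.lift c G₂.continuousSubtype f₂ h₂)
  -- Both maps restrict to the inclusions of the factors, so uniqueness makes `s` a section.
  have hid : (CocycleExtension.proj c).comp s = ContinuousMonoidHom.id G :=
    (huniv G hG G₁.continuousSubtype G₂.continuousSubtype).unique
      ⟨fun x => (congrArg CocycleExtension.snd (hs₁ x) :),
        fun x => (congrArg CocycleExtension.snd (hs₂ x) :)⟩ ⟨fun _ => rfl, fun _ => rfl⟩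
  have hsnd : ∀ g, (s g).snd = g := fun g => DFunLike.congr_fun hid g
  refine ⟨⟨fun g => -(s g).fst, by fun_prop⟩, ?_, fun x => ?_, fun x => ?_⟩
  · ext ⟨g, h⟩
    have := congrArg CocycleExtension.fst ((map_mul s g h).trans (CocycleExtension.mul_def _ _))
    simp only [hsnd, CocycleExtension.fst_mk] at this
    change -(s h).fst - -(s (g * h)).fst + -(s g).fst = c.1 (g, h)
    linear_combination this
  · exact (congrArg (fun y => -CocycleExtension.fst y) (hs₁ x)).trans (neg_neg (f₁ x))
  · exact (congrArg (fun y => -CocycleExtension.fst y) (hs₂ x)).trans (neg_neg (f₂ x))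

theorem IsFreeProPProduct.symm {p : ℕ} {G : Type u} [Group G]
    [TopologicalSpace G] [IsTopologicalGroup G] {G₁ G₂ : Subgroup G}
    (h : IsFreeProPProduct p G₁ G₂) : IsFreeProPProduct p G₂ G₁ := by
  obtain ⟨hG, h₁, h₂, huniv⟩ := h
  refine ⟨hG, h₂, h₁, fun H _ _ _ hH f₂ f₁ => ?_⟩
  simpa only [and_comm] using huniv H hH f₁ f₂

/-- A nontrivial finite `p`-group has a nonzero homomorphism to `ZMod p`. -/
theorem IsPGroup.exists_hom_zmod_ne_one {p : ℕ} [Fact p.Prime] {Q : Type*} [Group Q] [Finite Q]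
    [Nontrivial Q] (hQ : IsPGroup p Q) : ∃ φ : Q →* Multiplicative (ZMod p), φ ≠ 1 := by
  have hp : p.Prime := Fact.out
  obtain ⟨n, hn0, hn⟩ := (IsPGroup.nontrivial_iff_card hQ).1 inferInstance
  obtain ⟨m, rfl⟩ : ∃ m, n = m + 1 := ⟨n - 1, by omega⟩
  obtain ⟨M, hM⟩ := Sylow.exists_subgroup_card_pow_prime (G := Q) p (n := m)
    (by rw [hn]; exact pow_dvd_pow p m.le_succ)
  have hidx : M.index = p := by
    have := M.card_mul_index
    rw [hM, hn, pow_succ] at this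
    exact Nat.eq_of_mul_eq_mul_left (pow_pos hp.pos m) this
  have hnorm : M.Normal := by
    -- A subgroup whose index is the least prime factor of the order is normal.
    refine Subgroup.normal_of_index_eq_minFac_card ?_
    rw [hidx, hn, hp.pow_minFac m.succ_ne_zero]
  have hcard : Nat.card (Q ⧸ M) = p := hidx
  have : IsCyclic (Q ⧸ M) := isCyclic_of_prime_card hcard
  let e : Q ⧸ M ≃* Multiplicative (ZMod p) :=
    mulEquivOfCyclicCardEq (hcard.trans (Nat.card_zmod p).symm)
  refine ⟨e.toMonoidHom.comp (QuotientGroup.mk' M), fun h => hp.one_lt.ne' ?_⟩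
  rw [← hidx, Subgroup.index_eq_one, Subgroup.eq_top_iff']
  intro x
  rw [← QuotientGroup.eq_one_iff]
  exact e.injective ((DFunLike.congr_fun h x).trans (map_one e).symm)

/-- A nontrivial pro-`p` group has a nonzero continuous homomorphism to `ZMod p`. -/
theorem IsProP.exists_H1_ne_zero {p : ℕ} [Fact p.Prime] {G : Type u} [Group G]
    [TopologicalSpace G] [IsTopologicalGroup G] [Nontrivial G] (hG : IsProP p G) :
    ∃ χ : H1 p G, χ ≠ 0 := by
  obtain ⟨_, _, _, hq⟩ := hG
  obtain ⟨g, hg⟩ := exists_ne (1 : G)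
  obtain ⟨N, hN⟩ := ProfiniteGrp.exist_openNormalSubgroup_sub_open_nhds_of_one
    (isOpen_compl_singleton (x := g)) (by simpa using hg.symm)
  have hgN : g ∉ N.toSubgroup := fun h => hN h rfl
  have : Nontrivial (G ⧸ N.toSubgroup) :=
    ⟨g, 1, fun h => hgN ((QuotientGroup.eq_one_iff g).1 h)⟩
  have : Finite (G ⧸ N.toSubgroup) := Subgroup.quotient_finite_of_isOpen _ N.isOpen'
  have : DiscreteTopology (G ⧸ N.toSubgroup) := QuotientGroup.discreteTopology N.isOpen'
  obtain ⟨φ, hφ⟩ := (hq N).exists_hom_zmod_ne_one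
  refine ⟨⟨⟨fun x => (φ (QuotientGroup.mk x)).toAdd,
    (continuous_of_discreteTopology (f := fun y => (φ y).toAdd)).comp
      QuotientGroup.continuous_mk⟩, ?_⟩, fun h => hφ ?_⟩
  · ext ⟨x, y⟩
    change (φ y).toAdd - (φ ((x * y : G) : G ⧸ N.toSubgroup)).toAdd + (φ x).toAdd = 0
    rw [QuotientGroup.mk_mul, map_mul, toAdd_mul]
    ring
  · refine MonoidHom.ext fun y => ?_
    obtain ⟨x, rfl⟩ := QuotientGroup.mk_surjective y
    exact congrArg (fun χ : H1 p G => χ.1 x) h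

/-- There is a nonzero class in `H¹` that vanishes on the second free factor. -/
theorem IsFreeProPProduct.exists_H1_ne_zero {p : ℕ} [Fact p.Prime] {G : Type u} [Group G]
    [TopologicalSpace G] [IsTopologicalGroup G] {G₁ G₂ : Subgroup G}
    (h : IsFreeProPProduct p G₁ G₂) (hne : G₁ ≠ ⊥) :
    ∃ χ : H1 p G, χ ≠ 0 ∧ ∀ x : G₂, χ.1 x = 0 := by
  have := (Subgroup.nontrivial_iff_ne_bot G₁).2 hne
  obtain ⟨ψ, hψ⟩ := h.2.1.exists_H1_ne_zero
  -- For the zero cocycle, gluing cochains means gluing homomorphisms, here `ψ` and `0`.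
  obtain ⟨f, hf, hf₁, hf₂⟩ := h.exists_cochain 0 ψ.1 0
    (fun x y => by rw [H1.map_mul]; simp) (fun x y => by simp)
  refine ⟨⟨f, hf⟩, fun h0 => hψ ?_, hf₂⟩
  ext x
  rw [← hf₁ x]
  exact congrArg (fun χ : H1 p G => χ.1 x) h0

theorem mainTheorem10 (p : ℕ) [Fact p.Prime] (G : Type u) [Group G] [TopologicalSpace G]
    [IsTopologicalGroup G] (hG : IsDemushkin p G) :
    ¬ ∃ G₁ G₂ : Subgroup G, IsClosed (G₁ : Set G) ∧ IsClosed (G₂ : Set G) ∧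
      G₁ ≠ ⊥ ∧ G₂ ≠ ⊥ ∧ IsFreeProPProduct p G₁ G₂ := by
  rintro ⟨G₁, G₂, -, -, hne₁, hne₂, h⟩
  obtain ⟨χ₁, hχ₁, hres₁⟩ := h.exists_H1_ne_zero hne₁
  obtain ⟨χ₂, hχ₂, hres₂⟩ := h.symm.exists_H1_ne_zero hne₂
  have hsep : ∀ χ : H1 p G, χ ≠ 0 → ∃ ψ, cup p G χ ψ ≠ 0 := fun χ hχ => by
    by_contra! hψ
    exact hχ (hG.nondegenerate.1 χ hψ)
  obtain ⟨ψ₁, hψ₁⟩ := hsep χ₁ hχ₁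
  obtain ⟨ψ₂, hψ₂⟩ := hsep χ₂ hχ₂
  obtain ⟨a, ha⟩ := (finrank_eq_one_iff_of_nonzero' _ hψ₂).1 hG.finrank_H2 (cup p G χ₁ ψ₁)
  have hcob : cupCocycle χ₁ ψ₁ - a • cupCocycle χ₂ ψ₂ ∈ B2 p G := by
    rw [← Submodule.Quotient.mk_eq_zero, Submodule.Quotient.mk_sub, Submodule.Quotient.mk_smul,
      sub_eq_zero]
    exact ha.symm
  obtain ⟨f, hf⟩ := hcob
  have hf' : ∀ x y, f y - f (x * y) + f x = χ₁.1 x * ψ₁.1 y - a * (χ₂.1 x * ψ₂.1 y) :=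
    fun x y => congrArg (fun d : C(G × G, ZMod p) => d (x, y)) hf
  -- On `G₁` the `χ₂` term vanishes, so `f` bounds `χ₁ ∪ ψ₁`; on `G₂` this cocycle is zero.
  obtain ⟨f', hf₁, -, -⟩ := h.exists_cochain (cupCocycle χ₁ ψ₁)
    (f.comp ⟨Subtype.val, continuous_subtype_val⟩) 0
    (fun x y => by
      change f y - f (x * y) + f x = χ₁.1 x * ψ₁.1 y
      rw [hf', hres₂]; ring)
    (fun x y => by
      change (0 : ZMod p) - 0 + 0 = χ₁.1 x * ψ₁.1 y
      rw [hres₁]; ring)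
  exact hψ₁ ((Submodule.Quotient.mk_eq_zero _).2 ⟨f', hf₁⟩)
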